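/- Let $d\ge 3$ be an integer, let $a,b\in\mathbb R$ satisfy $a<b<a+1$ and $a<\frac{d-2}{2}$, and put $$p=\frac{2d}{d-2+2(b-a)},\qquad n=\frac{d}{1+a-b}\in(d,\infty),\qquad \alpha=1+a-\frac{pb}{2}>0 .$$ Given a $d$-dimensional weighted Riemannian manifold $(M,\mathfrak g,\mu)$, where $\mathfrak g=(\mathfrak g^{ij})$ is the inverse of the metric, write $d\mu=e^{-W}dV_{\mathfrak g}$ with $dV_{\mathfrak g}$ the Riemannian volume and $W\in C^\infty(M)$, let $\Gamma(f)=|\nabla f|^2_{\mathfrak g}$ be the carré du champ, $\Delta_{\mathfrak g}$ the Laplace–Beltrami operator, $sc_{\mathfrak g}$ the scalar curvature, and for $\gamma\in\mathbb R$ set $$S_\gamma(\mu,\Gamma)=\theta_n(\gamma)\bigl[sc_{\mathfrak g}-\gamma\,\Delta_{\mathfrak g}W+\beta_n(\gamma)\,\Gamma(W)\bigr],$$ $$\beta_n(\gamma)=\frac{\gamma(n-2d+2)-2(d-1)}{2(n-d)},\qquad \theta_n(\gamma)=\frac{n-2}{4(d-1)-2\gamma(n-d)} .$$ Consider the following three weighted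 Riemannian manifolds. - The Euclidean CKN space: $\mathbb R^d\setminus\{0\}$ with $\hat{\mathfrak g}^{ij}=|x|^{2(1-\alpha)}\delta^{ij}$ and $d\hat\mu=|x|^{-bp}dx$. - The spherical CKN space: $\mathbb R^d\setminus\{0\}$ with $\bar{\mathfrak g}^{ij}=|x|^{2(1-\alpha)}\frac{(1+|x|^{2\alpha})^2}{4}\delta^{ij}$ and $d\bar\mu=2^n\frac{|x|^{-bp}}{(1+|x|^{2\alpha})^n}dx$. - The hyperbolic CKN space: $B\setminus\{0\}$, where $B$ is the open unit ball of $\mathbb R^d$, with $\tilde{\mathfrak g}^{ij}=|x|^{2(1-\alpha)}\frac{(1-|x|^{2\alpha})^2}{4}\delta^{ij}$ and $d\tilde\mu=2^n\frac{|x|^{-bp}}{(1-|x|^{2\alpha})^n}dx$. Let $\hat\Gamma,\bar\Gamma,\tilde\Gamma$ be the respective carré du champ operators, and let $$\mathfrak B_{DGZ}=(d-2)-(n-2)\alpha^2,\qquad \gamma_0=-\frac{2(d-1)}{\alpha^2(n-d)(n-2)}\,\mathfrak B_{DGZ}.$$ Then, at every point of the respective manifold, $$S_{\gamma_0}(\hat\mu,\hat\Gamma)=0,\qquad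 S_{\gamma_0}(\bar\mu,\bar\Gamma)=\frac{n(n-2)}{4}\alpha^2,\qquad S_{\gamma_0}(\tilde\mu,\tilde\Gamma)=-\frac{n(n-2)}{4}\alpha^2 .$$ -/

import Mathlib

open MeasureTheory Set
open scoped ContDiff

noncomputable section

/-! ### Weighted Riemannian manifolds in one global chart -/

/-- `i`-th partial derivative of a function on `ℝ^d`. -/
def pd {d : ℕ} (i : Fin d) (f : EuclideanSpace ℝ (Fin d) → ℝ)
    (x : EuclideanSpace ℝ (Fin d)) : ℝ :=
  fderiv ℝ f x (EuclideanSpace.single i 1)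

/-- Riemannian volume of the metric `g = 𝔤⁻¹` on `U`: the measure `√(det g) dx` on `U`. -/
def riemannianVolume {d : ℕ} (U : Set (EuclideanSpace ℝ (Fin d)))
    (𝔤 : EuclideanSpace ℝ (Fin d) → Matrix (Fin d) (Fin d) ℝ) :
    Measure (EuclideanSpace ℝ (Fin d)) :=
  (volume.restrict U).withDensity (fun x => ENNReal.ofReal (Real.sqrt ((𝔤 x)⁻¹).det))

/-- `W` is a smooth weight of `μ`: `dμ = e^{-W} dV_g` on `U`. -/
def IsWeight {d : ℕ} (U : Set (EuclideanSpace ℝ (Fin d)))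
    (𝔤 : EuclideanSpace ℝ (Fin d) → Matrix (Fin d) (Fin d) ℝ)
    (μ : Measure (EuclideanSpace ℝ (Fin d))) (W : EuclideanSpace ℝ (Fin d) → ℝ) : Prop :=
  ContDiffOn ℝ ∞ W U ∧
    μ = (riemannianVolume U 𝔤).withDensity (fun x => ENNReal.ofReal (Real.exp (-W x)))

/-- A weighted Riemannian manifold `(M, 𝔤, μ)`, where `M` is an open subset of `ℝ^d`. The metric
is given by its matrix `𝔤^{ij}` with upper indices; `μ` has a smooth positive density with
respect to the Riemannian volume. -/
structure WeightedSpace (d : ℕ) where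
  carrier : Set (EuclideanSpace ℝ (Fin d))
  isOpen_carrier : IsOpen carrier
  cometric : EuclideanSpace ℝ (Fin d) → Matrix (Fin d) (Fin d) ℝ
  contDiffOn_cometric : ∀ i j, ContDiffOn ℝ ∞ (fun x => cometric x i j) carrier
  posDef_cometric : ∀ x ∈ carrier, (cometric x).PosDef
  μ : Measure (EuclideanSpace ℝ (Fin d))
  exists_weight : ∃ W, IsWeight carrier cometric μ W

namespace WeightedSpace

variable {d : ℕ} (X : WeightedSpace d)

/-- The metric `g_{ij}` with lower indices. -/
def metric (x : EuclideanSpace ℝ (Fin d)) : Matrix (Fin d) (Fin d) ℝ := (X.cometric x)⁻¹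

/-- The weight `W`, defined by `dμ = e^{-W} dV_g`; it is unique on the manifold,
see `weight_unique` below. -/
def weight : EuclideanSpace ℝ (Fin d) → ℝ := X.exists_weight.choose

/-- The carré du champ `Γ(f) = |∇f|² = 𝔤^{ij} ∂_i f ∂_j f`. -/
def carreDuChamp (f : EuclideanSpace ℝ (Fin d) → ℝ) (x : EuclideanSpace ℝ (Fin d)) : ℝ :=
  ∑ i, ∑ j, X.cometric x i j * pd i f x * pd j f x

/-- The Laplace–Beltrami operator `Δf = (det g)^{-1/2} ∂_i ((det g)^{1/2} 𝔤^{ij} ∂_j f)`. -/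
def laplaceBeltrami (f : EuclideanSpace ℝ (Fin d) → ℝ) (x : EuclideanSpace ℝ (Fin d)) : ℝ :=
  (Real.sqrt (X.metric x).det)⁻¹ *
    ∑ i, pd i (fun y => ∑ j, Real.sqrt (X.metric y).det * X.cometric y i j * pd j f y) x

/-- Christoffel symbols `Γ^k_{ij}` of the Levi-Civita connection. -/
def christoffel (k i j : Fin d) (x : EuclideanSpace ℝ (Fin d)) : ℝ :=
  ∑ l, (1 / 2 : ℝ) * X.cometric x k l *
    (pd i (fun y => X.metric y j l) x + pd j (fun y => X.metric y i l) x
      - pd l (fun y => X.metric y i j) x)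

/-- Riemann curvature
`R^l_{ijk} = ∂_j Γ^l_{ik} - ∂_k Γ^l_{ij} + Γ^l_{jm} Γ^m_{ik} - Γ^l_{km} Γ^m_{ij}`. -/
def riemann (l i j k : Fin d) (x : EuclideanSpace ℝ (Fin d)) : ℝ :=
  pd j (X.christoffel l i k) x - pd k (X.christoffel l i j) x
    + ∑ m, (X.christoffel l j m x * X.christoffel m i k x
      - X.christoffel l k m x * X.christoffel m i j x)

/-- Ricci curvature `Ric_{ik} = R^l_{ilk}`. -/
def ricci (i k : Fin d) (x : EuclideanSpace ℝ (Fin d)) : ℝ := ∑ l, X.riemann l i l k x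

/-- Scalar curvature `sc = 𝔤^{ik} Ric_{ik}` (positive on round spheres). -/
def scalarCurvature (x : EuclideanSpace ℝ (Fin d)) : ℝ :=
  ∑ i, ∑ k, X.cometric x i k * X.ricci i k x

end WeightedSpace

/-- `β_n(γ)`, for topological dimension `d`. -/
def betaCoeff (d : ℕ) (n γ : ℝ) : ℝ :=
  (γ * (n - 2 * d + 2) - 2 * (d - 1)) / (2 * (n - d))

/-- `θ_n(γ)`, for topological dimension `d`. -/
def thetaCoeff (d : ℕ) (n γ : ℝ) : ℝ :=
  (n - 2) / (4 * (d - 1) - 2 * γ * (n - d))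

/-- The function `S_γ(μ, Γ) = θ_n(γ) [sc - γ ΔW + β_n(γ) Γ(W)]`. -/
def WeightedSpace.invariantS {d : ℕ} (X : WeightedSpace d) (n γ : ℝ)
    (x : EuclideanSpace ℝ (Fin d)) : ℝ :=
  thetaCoeff d n γ * (X.scalarCurvature x - γ * X.laplaceBeltrami X.weight x
    + betaCoeff d n γ * X.carreDuChamp X.weight x)

/-! ### Uniqueness of the weight, and metrics of the form `𝔤^{ij} = q δ^{ij}` -/

theorem isWeight_iff {d : ℕ} {U : Set (EuclideanSpace ℝ (Fin d))} (hU : IsOpen U)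
    {𝔤 : EuclideanSpace ℝ (Fin d) → Matrix (Fin d) (Fin d) ℝ}
    (h𝔤 : ∀ i j, ContDiffOn ℝ ∞ (fun x => 𝔤 x i j) U) (hpos : ∀ x ∈ U, (𝔤 x).PosDef)
    {μ : Measure (EuclideanSpace ℝ (Fin d))} {W : EuclideanSpace ℝ (Fin d) → ℝ} :
    IsWeight U 𝔤 μ W ↔ ContDiffOn ℝ ∞ W U ∧ μ = (volume.restrict U).withDensity
      (fun x => ENNReal.ofReal (Real.sqrt ((𝔤 x)⁻¹).det * Real.exp (-W x))) := by
  unfold IsWeight riemannianVolume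
  refine and_congr_right fun hW => ?_
  have hdet : ContinuousOn (fun x => (𝔤 x).det) U := by
    have : ContinuousOn 𝔤 U := continuousOn_pi.2 fun i => continuousOn_pi.2 fun j =>
      (h𝔤 i j).continuousOn
    exact (Continuous.matrix_det continuous_id).comp_continuousOn this
  have h1 : ContinuousOn (fun x => Real.sqrt ((𝔤 x)⁻¹).det) U := by
    refine Real.continuous_sqrt.comp_continuousOn ?_
    simp only [Matrix.det_nonsing_inv, Ring.inverse_eq_inv']
    exact hdet.inv₀ fun x hx => (hpos x hx).det_pos.ne'
  have h2 : ContinuousOn (fun x => Real.exp (-W x)) U :=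
    Real.continuous_exp.comp_continuousOn hW.continuousOn.neg
  have m1 := ENNReal.continuous_ofReal.comp_continuousOn h1
    |>.aemeasurable hU.measurableSet (μ := volume)
  have m2 := ENNReal.continuous_ofReal.comp_continuousOn h2
    |>.aemeasurable hU.measurableSet (μ := volume)
  have := withDensity_mul₀ m1 m2
  simp only [Function.comp_def] at this
  rw [← this]
  simp only [Pi.mul_def, ENNReal.ofReal_mul (Real.sqrt_nonneg _)]

theorem WeightedSpace.weight_isWeight {d : ℕ} (X : WeightedSpace d) :
    IsWeight X.carrier X.cometric X.μ X.weight := X.exists_weight.choose_spec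

theorem WeightedSpace.weight_unique {d : ℕ} (X : WeightedSpace d)
    {W : EuclideanSpace ℝ (Fin d) → ℝ} (hW : IsWeight X.carrier X.cometric X.μ W) :
    EqOn X.weight W X.carrier := by
  have hV := X.weight_isWeight
  rw [isWeight_iff X.isOpen_carrier X.contDiffOn_cometric X.posDef_cometric] at hV hW
  have hdet : ContinuousOn (fun x => (X.cometric x).det) X.carrier := by
    have : ContinuousOn X.cometric X.carrier := continuousOn_pi.2 fun i =>
      continuousOn_pi.2 fun j => (X.contDiffOn_cometric i j).continuousOn
    exact (Continuous.matrix_det continuous_id).comp_continuousOn this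
  have h1 : ContinuousOn (fun x => Real.sqrt ((X.cometric x)⁻¹).det) X.carrier := by
    refine Real.continuous_sqrt.comp_continuousOn ?_
    simp only [Matrix.det_nonsing_inv, Ring.inverse_eq_inv']
    exact hdet.inv₀ fun x hx => (X.posDef_cometric x hx).det_pos.ne'
  have key : ∀ V : EuclideanSpace ℝ (Fin d) → ℝ, ContDiffOn ℝ ∞ V X.carrier →
      ContinuousOn (fun x => ENNReal.ofReal
        (Real.sqrt ((X.cometric x)⁻¹).det * Real.exp (-V x))) X.carrier := fun V hV =>
    ENNReal.continuous_ofReal.comp_continuousOn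
      (h1.mul (Real.continuous_exp.comp_continuousOn hV.continuousOn.neg))
  have hae := (withDensity_eq_iff_of_sigmaFinite
    ((key _ hV.1).aemeasurable X.isOpen_carrier.measurableSet)
    ((key _ hW.1).aemeasurable X.isOpen_carrier.measurableSet)).1 (hV.2.symm.trans hW.2)
  have heq := Measure.eqOn_open_of_ae_eq hae X.isOpen_carrier (key _ hV.1) (key _ hW.1)
  intro x hx
  have hs : 0 < Real.sqrt ((X.cometric x)⁻¹).det :=
    Real.sqrt_pos.2 (X.posDef_cometric x hx).inv.det_pos
  have := heq hx
  simp only at this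
  rw [ENNReal.ofReal_eq_ofReal_iff (by positivity) (by positivity)] at this
  have := Real.exp_injective (mul_left_cancel₀ hs.ne' this)
  linarith

/-- The weighted space with `𝔤^{ij} = q δ^{ij}` and `dμ = m dx` on the open set `U`. -/
def WeightedSpace.ofScalar {d : ℕ} (U : Set (EuclideanSpace ℝ (Fin d))) (hU : IsOpen U)
    (q m : EuclideanSpace ℝ (Fin d) → ℝ) (hq : ContDiffOn ℝ ∞ q U) (hq0 : ∀ x ∈ U, 0 < q x)
    (hm : ContDiffOn ℝ ∞ m U) (hm0 : ∀ x ∈ U, 0 < m x) : WeightedSpace d where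
  carrier := U
  isOpen_carrier := hU
  cometric x := q x • (1 : Matrix (Fin d) (Fin d) ℝ)
  contDiffOn_cometric i j := by
    simp only [Matrix.smul_apply, smul_eq_mul]
    exact hq.mul contDiffOn_const
  posDef_cometric x hx := Matrix.PosDef.one.smul (hq0 x hx)
  μ := (volume.restrict U).withDensity (fun x => ENNReal.ofReal (m x))
  exists_weight := by
    have hdet : ∀ x, ((q x • (1 : Matrix (Fin d) (Fin d) ℝ))⁻¹).det = (q x ^ d)⁻¹ := fun x => by
      rw [Matrix.det_nonsing_inv, Ring.inverse_eq_inv', Matrix.det_smul]; simp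
    have hs : ∀ x ∈ U, 0 < Real.sqrt (q x ^ d)⁻¹ := fun x hx =>
      Real.sqrt_pos.2 (inv_pos.2 (pow_pos (hq0 x hx) d))
    refine ⟨fun x => -Real.log (m x / Real.sqrt (q x ^ d)⁻¹), ?_⟩
    rw [isWeight_iff hU (fun i j => by
      simp only [Matrix.smul_apply, smul_eq_mul]
      exact hq.mul contDiffOn_const) (fun x hx => Matrix.PosDef.one.smul (hq0 x hx))]
    constructor
    · refine (ContDiffOn.log (hm.div (ContDiffOn.sqrt ((hq.pow d).inv ?_) ?_) ?_) ?_).neg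
      · exact fun x hx => (pow_pos (hq0 x hx) d).ne'
      · exact fun x hx => (inv_pos.2 (pow_pos (hq0 x hx) d)).ne'
      · exact fun x hx => (hs x hx).ne'
      · exact fun x hx => (div_pos (hm0 x hx) (hs x hx)).ne'
    · refine withDensity_congr_ae ?_
      filter_upwards [ae_restrict_mem hU.measurableSet] with x hx
      rw [hdet, neg_neg, Real.exp_log (div_pos (hm0 x hx) (hs x hx)),
        mul_div_cancel₀ _ (hs x hx).ne']

/-! ### The CKN spaces -/

namespace CKN

/-- The critical exponent `p`. -/
def p (d : ℕ) (a b : ℝ) : ℝ := 2 * d / (d - 2 + 2 * (b - a))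

/-- The intrinsic dimension `n`. -/
def n (d : ℕ) (a b : ℝ) : ℝ := d / (1 + a - b)

/-- The parameter `α`. -/
def α (d : ℕ) (a b : ℝ) : ℝ := 1 + a - p d a b * b / 2

/-- The constant `𝔅_DGZ`. -/
def bDGZ (d : ℕ) (a b : ℝ) : ℝ := (d - 2) - (n d a b - 2) * α d a b ^ 2

/-- The value `γ₀`. -/
def γ₀ (d : ℕ) (a b : ℝ) : ℝ :=
  -(2 * (d - 1) / (α d a b ^ 2 * (n d a b - d) * (n d a b - 2))) * bDGZ d a b

theorem α_pos {d : ℕ} {a b : ℝ} (hd : 3 ≤ d) (hab : a ≤ b) (hba : b < a + 1)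
    (ha : a < ((d : ℝ) - 2) / 2) : 0 < α d a b := by
  have hd' : (3 : ℝ) ≤ d := by exact_mod_cast hd
  have h : (0 : ℝ) < d - 2 + 2 * (b - a) := by linarith
  have : α d a b = 2 * (((d : ℝ) - 2) / 2 - a) * (a + 1 - b) / (d - 2 + 2 * (b - a)) := by
    unfold α p
    field_simp
    ring
  rw [this]
  exact div_pos (mul_pos (by linarith) (by linarith)) h

theorem contDiffOn_norm_rpow {d : ℕ} (s : ℝ) {U : Set (EuclideanSpace ℝ (Fin d))}
    (hU : ∀ x ∈ U, x ≠ 0) : ContDiffOn ℝ ∞ (fun x => ‖x‖ ^ s) U := fun x hx =>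
  ((contDiffAt_norm ℝ (hU x hx)).rpow_const_of_ne
    (norm_ne_zero_iff.2 (hU x hx))).contDiffWithinAt

/-- The Euclidean CKN space, on `ℝ^d \ {0}`. -/
def euclidean (d : ℕ) (a b : ℝ) : WeightedSpace d :=
  WeightedSpace.ofScalar {0}ᶜ isOpen_compl_singleton
    (fun x => ‖x‖ ^ (2 * (1 - α d a b)))
    (fun x => ‖x‖ ^ (-(b * p d a b)))
    (contDiffOn_norm_rpow _ fun _ hx => hx)
    (fun _ hx => Real.rpow_pos_of_pos (norm_pos_iff.2 hx) _)
    (contDiffOn_norm_rpow _ fun _ hx => hx)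
    (fun _ hx => Real.rpow_pos_of_pos (norm_pos_iff.2 hx) _)

/-- The spherical CKN space, on `ℝ^d \ {0}`. -/
def spherical (d : ℕ) (a b : ℝ) : WeightedSpace d :=
  WeightedSpace.ofScalar {0}ᶜ isOpen_compl_singleton
    (fun x => ‖x‖ ^ (2 * (1 - α d a b)) * ((1 + ‖x‖ ^ (2 * α d a b)) ^ 2 / 4))
    (fun x => 2 ^ n d a b * (‖x‖ ^ (-(b * p d a b)) / (1 + ‖x‖ ^ (2 * α d a b)) ^ n d a b))
    ((contDiffOn_norm_rpow _ fun _ hx => hx).mul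
      (((contDiffOn_const.add (contDiffOn_norm_rpow _ fun _ hx => hx)).pow 2).div_const 4))
    (fun x hx => by
      have := norm_pos_iff.2 hx
      positivity)
    (contDiffOn_const.mul ((contDiffOn_norm_rpow _ fun _ hx => hx).div
      ((contDiffOn_const.add (contDiffOn_norm_rpow _ fun _ hx => hx)).rpow_const_of_ne
        fun x _ => by positivity)
      fun x _ => by positivity))
    (fun x hx => by
      have := norm_pos_iff.2 hx
      positivity)

theorem one_sub_pos {d : ℕ} {s : ℝ} (hs : 0 < s) {x : EuclideanSpace ℝ (Fin d)}
    (hx : x ∈ Metric.ball (0 : EuclideanSpace ℝ (Fin d)) 1 \ {0}) :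
    0 < 1 - ‖x‖ ^ (2 * s) :=
  sub_pos.2 (Real.rpow_lt_one (norm_nonneg x) (mem_ball_zero_iff.1 hx.1) (by positivity))

/-- The hyperbolic CKN space, on the punctured open unit ball (for `α > 0`). -/
def hyperbolic (d : ℕ) (a b : ℝ) (hα : 0 < α d a b) : WeightedSpace d :=
  WeightedSpace.ofScalar (Metric.ball 0 1 \ {0})
    (Metric.isOpen_ball.sdiff isClosed_singleton)
    (fun x => ‖x‖ ^ (2 * (1 - α d a b)) * ((1 - ‖x‖ ^ (2 * α d a b)) ^ 2 / 4))
    (fun x => 2 ^ n d a b * (‖x‖ ^ (-(b * p d a b)) / (1 - ‖x‖ ^ (2 * α d a b)) ^ n d a b))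
    ((contDiffOn_norm_rpow _ fun _ hx => hx.2).mul
      (((contDiffOn_const.sub (contDiffOn_norm_rpow _ fun _ hx => hx.2)).pow 2).div_const 4))
    (fun x hx => by
      have := norm_pos_iff.2 hx.2
      have := one_sub_pos hα hx
      positivity)
    (contDiffOn_const.mul ((contDiffOn_norm_rpow _ fun _ hx => hx.2).div
      ((contDiffOn_const.sub (contDiffOn_norm_rpow _ fun _ hx => hx.2)).rpow_const_of_ne
        fun x hx => (one_sub_pos hα hx).ne')
      fun x hx => (Real.rpow_pos_of_pos (one_sub_pos hα hx) _).ne'))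
    (fun x hx => by
      have := norm_pos_iff.2 hx.2
      have := one_sub_pos hα hx
      positivity)

end CKN

end

/-!
In the coordinates `t = log ‖x‖`, `ω = x / ‖x‖`, each of the three spaces is conformal to the
cylinder `ℝ × S^{d-1}`: its metric is `c(t)⁻² (dt² + dω²)` and its measure is `c(t)⁻ⁿ dt dω`, where
`c(t)` is `exp (-αt)`, `cosh (αt)` and `-sinh (αt)` respectively. The weight is
`W = (n - d) log c(t)`, and for every admissible `γ`
`S_γ = θ_n(γ) (d - 1) (d - 2) c² + (n - 2) / 2 · c c'' - n (n - 2) / 4 · c'²`.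
The three profiles satisfy `c'' = α² c` and `c'² = α² (c² - ε)` with `ε = 0, 1, -1`, so the
coefficient of `c²` vanishes, leaving `S_γ = ε n (n - 2) α² / 4`, exactly when
`θ_n(γ) (d - 1) (d - 2) = (n - 2)² α² / 4`; this equation determines `γ = γ₀`.
-/

open Filter Topology InnerProductSpace
open scoped Gradient Laplacian

theorem exp_two_mul_log_add_log {r s : ℝ} (hr : 0 < r) (hs : 0 < s) :
    Real.exp (2 * (Real.log r + Real.log s)) = (r * s) ^ 2 := by
  rw [← Real.log_mul hr.ne' hs.ne', two_mul, Real.exp_add, Real.exp_log (mul_pos hr hs), pow_two]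

theorem two_rpow_mul_div_rpow (r s : ℝ) {t : ℝ} (ht : 0 ≤ t) :
    2 ^ s * (r / t ^ s) = r / (t / 2) ^ s := by
  rw [Real.div_rpow ht two_pos.le, div_div_eq_mul_div, mul_div_left_comm, mul_div_assoc]

theorem deriv_exp_neg_eq : deriv (fun t => Real.exp (-t)) = fun t => -Real.exp (-t) :=
  funext fun t => by simpa using (hasDerivAt_neg t).exp.deriv

theorem deriv_deriv_log {c : ℝ → ℝ} {t : ℝ} (hc : ContDiffAt ℝ 2 c t) (h0 : c t ≠ 0) :
    deriv (deriv fun s => Real.log (c s)) t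
      = (deriv (deriv c) t * c t - deriv c t ^ 2) / c t ^ 2 := by
  have hderiv : deriv (fun s => Real.log (c s)) =ᶠ[𝓝 t] fun s => deriv c s / c s := by
    filter_upwards [hc.continuousAt.eventually_ne h0, hc.eventually (by simp)] with s hs0 hs
    exact deriv.log (hs.differentiableAt two_ne_zero) hs0
  have hc' : DifferentiableAt ℝ (deriv c) t :=
    ((hc.fderiv_right (m := 1) (by norm_num)).differentiableAt one_ne_zero).clm_apply
      (differentiableAt_const 1)
  rw [hderiv.deriv_eq, deriv_fun_div hc' (hc.differentiableAt two_ne_zero) h0, ← pow_two]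

section PartialDerivatives

variable {d : ℕ} {f g : EuclideanSpace ℝ (Fin d) → ℝ} {x : EuclideanSpace ℝ (Fin d)}

theorem pd_congr_of_eventuallyEq (h : f =ᶠ[𝓝 x] g) (i : Fin d) : pd i f x = pd i g x := by
  rw [pd, pd, h.fderiv_eq]

theorem pd_add (hf : DifferentiableAt ℝ f x) (hg : DifferentiableAt ℝ g x) (i : Fin d) :
    pd i (fun y => f y + g y) x = pd i f x + pd i g x := by
  simp only [pd, fderiv_fun_add hf hg, add_apply]

theorem pd_const_mul (c : ℝ) (f : EuclideanSpace ℝ (Fin d) → ℝ) (i : Fin d)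
    (x : EuclideanSpace ℝ (Fin d)) : pd i (fun y => c * f y) x = c * pd i f x := by
  rw [pd, show (fun y => c * f y) = c • f from rfl, fderiv_const_smul_field]
  rfl

theorem pd_mul (hf : DifferentiableAt ℝ f x) (hg : DifferentiableAt ℝ g x) (i : Fin d) :
    pd i (fun y => f y * g y) x = pd i f x * g x + f x * pd i g x := by
  simp only [pd, fderiv_fun_mul hf hg, add_apply, smul_apply, smul_eq_mul]
  ring

theorem pd_exp (hf : DifferentiableAt ℝ f x) (i : Fin d) :
    pd i (fun y => Real.exp (f y)) x = Real.exp (f x) * pd i f x := by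
  simp only [pd, fderiv_exp hf, smul_apply, smul_eq_mul]

theorem differentiableAt_coord (i : Fin d) (x : EuclideanSpace ℝ (Fin d)) :
    DifferentiableAt ℝ (fun y : EuclideanSpace ℝ (Fin d) => y i) x :=
  (EuclideanSpace.proj (𝕜 := ℝ) i).differentiableAt

theorem pd_coord (i j : Fin d) (x : EuclideanSpace ℝ (Fin d)) :
    pd i (fun y => y j) x = if j = i then 1 else 0 := by
  rw [pd, show (fun y : EuclideanSpace ℝ (Fin d) => y j) = EuclideanSpace.proj (𝕜 := ℝ) j from rfl,
    ContinuousLinearMap.fderiv]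
  simp

theorem gradient_apply (f : EuclideanSpace ℝ (Fin d) → ℝ) (x : EuclideanSpace ℝ (Fin d))
    (i : Fin d) : ∇ f x i = pd i f x := by
  rw [pd, ← inner_gradient_left, EuclideanSpace.inner_single_right]
  simp

theorem inner_gradient_gradient (f g : EuclideanSpace ℝ (Fin d) → ℝ)
    (x : EuclideanSpace ℝ (Fin d)) :
    inner ℝ (∇ f x) (∇ g x) = ∑ i, pd i f x * pd i g x := by
  simp only [PiLp.inner_apply, gradient_apply, RCLike.inner_apply, conj_trivial, mul_comm]

theorem differentiableAt_pd (hf : ContDiffAt ℝ 2 f x) (i : Fin d) :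
    DifferentiableAt ℝ (pd i f) x :=
  ((hf.fderiv_right (m := 1) (by norm_num)).differentiableAt one_ne_zero).clm_apply
    (differentiableAt_const _)

theorem pd_pd (hf : ContDiffAt ℝ 2 f x) (i j : Fin d) :
    pd i (pd j f) x =
      fderiv ℝ (fderiv ℝ f) x (EuclideanSpace.single i 1) (EuclideanSpace.single j 1) := by
  have hf' : DifferentiableAt ℝ (fderiv ℝ f) x :=
    (hf.fderiv_right (m := 1) (by norm_num)).differentiableAt one_ne_zero
  unfold pd
  rw [fderiv_clm_apply hf' (differentiableAt_const _)]
  simp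

theorem pd_comm (hf : ContDiffAt ℝ 2 f x) (i j : Fin d) :
    pd i (pd j f) x = pd j (pd i f) x := by
  rw [pd_pd hf, pd_pd hf, (hf.isSymmSndFDerivAt (by simp)).eq]

theorem laplacian_eq_sum_pd_pd (hf : ContDiffAt ℝ 2 f x) : Δ f x = ∑ i, pd i (pd i f) x := by
  rw [laplacian_eq_iteratedFDeriv_orthonormalBasis f (EuclideanSpace.basisFun (Fin d) ℝ)]
  simp [iteratedFDeriv_two_apply, pd_pd hf]

end PartialDerivatives

section Radial

theorem hasGradientAt_comp_log_norm {E : Type*} [NormedAddCommGroup E] [InnerProductSpace ℝ E]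
    [CompleteSpace E] {h : ℝ → ℝ} {h' : ℝ} {x : E} (hx : x ≠ 0)
    (hh : HasDerivAt h h' (Real.log ‖x‖)) :
    HasGradientAt (fun y => h (Real.log ‖y‖)) ((h' / ‖x‖ ^ 2) • x) x := by
  have : 0 < ‖x‖ := norm_pos_iff.2 hx
  have hlog : HasFDerivAt (fun y : E => 2⁻¹ * Real.log (‖y‖ ^ 2)) _ x :=
    ((hasStrictFDerivAt_norm_sq x).hasFDerivAt.log (by positivity)).const_mul 2⁻¹
  simp only [Real.log_pow, Nat.cast_ofNat, inv_mul_cancel_left₀ (two_ne_zero' ℝ)] at hlog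
  rw [hasGradientAt_iff_hasFDerivAt]
  refine (hh.comp_hasFDerivAt x hlog).congr_fderiv ?_
  ext v
  simp only [smul_apply, coe_innerSL_apply, nsmul_eq_mul, Nat.cast_ofNat, smul_eq_mul, map_smul,
    toDual_apply_apply]
  field_simp

variable {d : ℕ} {h : ℝ → ℝ} {h' : ℝ} {x : EuclideanSpace ℝ (Fin d)}

theorem pd_comp_log_norm (hx : x ≠ 0) (hh : HasDerivAt h h' (Real.log ‖x‖)) (i : Fin d) :
    pd i (fun y => h (Real.log ‖y‖)) x = h' / ‖x‖ ^ 2 * x i := by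
  rw [← gradient_apply, (hasGradientAt_comp_log_norm hx hh).gradient]
  simp

theorem sum_pd_radial (hx : x ≠ 0) (hh : HasDerivAt h h' (Real.log ‖x‖)) :
    ∑ i, pd i (fun y => h (Real.log ‖y‖) * y i) x = h' + d * h (Real.log ‖x‖) := by
  have hx' : ‖x‖ ^ 2 ≠ 0 := by simpa using hx
  have hpd (i : Fin d) : pd i (fun y => h (Real.log ‖y‖) * y i) x
      = h' / ‖x‖ ^ 2 * x i ^ 2 + h (Real.log ‖x‖) := by
    rw [pd_mul (hasGradientAt_comp_log_norm hx hh).differentiableAt (differentiableAt_coord i x),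
      pd_comp_log_norm hx hh, pd_coord, if_pos rfl]
    ring
  simp only [hpd, Finset.sum_add_distrib, ← Finset.mul_sum, ← EuclideanSpace.real_norm_sq_eq,
    div_mul_cancel₀ h' hx', Finset.sum_const, Finset.card_univ, Fintype.card_fin, nsmul_eq_mul]

theorem inner_gradient_comp_log_norm {k : ℝ → ℝ} {k' : ℝ} (hx : x ≠ 0)
    (hh : HasDerivAt h h' (Real.log ‖x‖)) (hk : HasDerivAt k k' (Real.log ‖x‖)) :
    inner ℝ (∇ (fun y => h (Real.log ‖y‖)) x) (∇ (fun y => k (Real.log ‖y‖)) x)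
      = h' * k' / ‖x‖ ^ 2 := by
  have hx' : ‖x‖ ≠ 0 := norm_ne_zero_iff.2 hx
  rw [(hasGradientAt_comp_log_norm hx hh).gradient, (hasGradientAt_comp_log_norm hx hk).gradient,
    real_inner_smul_left, real_inner_smul_right, real_inner_self_eq_norm_sq]
  field_simp

theorem contDiffAt_comp_log_norm {m : WithTop ℕ∞} (hx : x ≠ 0)
    (hh : ContDiffAt ℝ m h (Real.log ‖x‖)) :
    ContDiffAt ℝ m (fun y => h (Real.log ‖y‖)) x :=
  hh.comp x ((contDiffAt_norm ℝ hx).log (norm_ne_zero_iff.2 hx))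

theorem laplacian_comp_log_norm (hx : x ≠ 0) (hh : ContDiffAt ℝ 2 h (Real.log ‖x‖)) :
    Δ (fun y : EuclideanSpace ℝ (Fin d) => h (Real.log ‖y‖)) x
      = (deriv (deriv h) (Real.log ‖x‖) + (d - 2) * deriv h (Real.log ‖x‖)) / ‖x‖ ^ 2 := by
  have hexp {y : EuclideanSpace ℝ (Fin d)} (hy : y ≠ 0) :
      Real.exp (-2 * Real.log ‖y‖) = (‖y‖ ^ 2)⁻¹ := by
    rw [neg_mul, Real.exp_neg, ← Nat.cast_two, ← Real.log_pow,
      Real.exp_log (pow_pos (norm_pos_iff.2 hy) 2)]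
  have hdiff : ∀ᶠ y in 𝓝 x, DifferentiableAt ℝ h (Real.log ‖y‖) :=
    ((continuous_norm.continuousAt.log (norm_ne_zero_iff.2 hx)).eventually
      (hh.eventually (by simp))).mono fun y hy => hy.differentiableAt two_ne_zero
  have hpd (i : Fin d) : pd i (fun y => h (Real.log ‖y‖)) =ᶠ[𝓝 x]
      fun y => (deriv h (Real.log ‖y‖) * Real.exp (-2 * Real.log ‖y‖)) * y i := by
    filter_upwards [hdiff, isOpen_ne.mem_nhds hx] with y hy hy0
    rw [pd_comp_log_norm hy0 hy.hasDerivAt, hexp hy0, div_eq_mul_inv]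
  have hderiv : DifferentiableAt ℝ (deriv h) (Real.log ‖x‖) :=
    ((hh.fderiv_right (m := 1) (by norm_num)).differentiableAt one_ne_zero).clm_apply
      (differentiableAt_const 1)
  rw [laplacian_eq_sum_pd_pd (contDiffAt_comp_log_norm hx hh)]
  simp only [fun i => pd_congr_of_eventuallyEq (hpd i) i]
  rw [sum_pd_radial (h := fun t => deriv h t * Real.exp (-2 * t)) hx
    (hderiv.hasDerivAt.mul ((hasDerivAt_id _).const_mul (-2)).exp)]
  simp only [hexp hx]
  ring

end Radial

namespace WeightedSpace

variable {d : ℕ}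

/-- The cometric of `X` is `𝔤^{ij} = e^{2u} δ^{ij}` with `u` smooth, i.e. `g = e^{-2u} |dx|²`. -/
structure IsConformallyFlat (X : WeightedSpace d) (u : EuclideanSpace ℝ (Fin d) → ℝ) : Prop where
  contDiffOn : ContDiffOn ℝ ∞ u X.carrier
  cometric_eq : ∀ x ∈ X.carrier,
    X.cometric x = Real.exp (2 * u x) • (1 : Matrix (Fin d) (Fin d) ℝ)

namespace IsConformallyFlat

variable {X : WeightedSpace d} {u f V : EuclideanSpace ℝ (Fin d) → ℝ}
  {x : EuclideanSpace ℝ (Fin d)}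

theorem contDiffAt (h : X.IsConformallyFlat u) (hx : x ∈ X.carrier) : ContDiffAt ℝ 2 u x :=
  (h.contDiffOn.contDiffAt (X.isOpen_carrier.mem_nhds hx)).of_le ENat.LEInfty.out

theorem cometric_apply (h : X.IsConformallyFlat u) (hx : x ∈ X.carrier) (i j : Fin d) :
    X.cometric x i j = if i = j then Real.exp (2 * u x) else 0 := by
  simp [h.cometric_eq x hx, Matrix.one_apply]

theorem metric_eq (h : X.IsConformallyFlat u) (hx : x ∈ X.carrier) :
    X.metric x = Real.exp (-2 * u x) • (1 : Matrix (Fin d) (Fin d) ℝ) := by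
  rw [metric, h.cometric_eq x hx]
  refine Matrix.inv_eq_right_inv ?_
  rw [smul_mul_smul_comm, ← Real.exp_add, one_mul, neg_mul, add_neg_cancel, Real.exp_zero,
    one_smul]

theorem sqrt_det_metric (h : X.IsConformallyFlat u) (hx : x ∈ X.carrier) :
    √(X.metric x).det = Real.exp (-d * u x) := by
  rw [h.metric_eq hx, Matrix.det_smul, Matrix.det_one, mul_one, Fintype.card_fin,
    ← Real.exp_nat_mul, ← Real.exp_half]
  ring_nf

theorem pd_metric (h : X.IsConformallyFlat u) (hx : x ∈ X.carrier) (i j k : Fin d) :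
    pd k (fun y => X.metric y i j) x
      = (if i = j then 1 else 0) * (-2 * Real.exp (-2 * u x) * pd k u x) := by
  have hmetric : (fun y => X.metric y i j) =ᶠ[𝓝 x]
      fun y => (if i = j then 1 else 0) * Real.exp (-2 * u y) := by
    filter_upwards [X.isOpen_carrier.mem_nhds hx] with y hy
    simp [h.metric_eq hy, Matrix.one_apply]
  have hu := (h.contDiffAt hx).differentiableAt two_ne_zero
  rw [pd_congr_of_eventuallyEq hmetric, pd_const_mul, pd_exp (hu.const_mul _), pd_const_mul]
  ring

theorem christoffel_eq (h : X.IsConformallyFlat u) (hx : x ∈ X.carrier) (k i j : Fin d) :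
    X.christoffel k i j x = (if i = j then 1 else 0) * pd k u x
      + (-(if k = i then 1 else 0) * pd j u x + -(if k = j then 1 else 0) * pd i u x) := by
  have hexp : Real.exp (2 * u x) * Real.exp (-2 * u x) = 1 := by
    rw [← Real.exp_add, neg_mul, add_neg_cancel, Real.exp_zero]
  rw [christoffel, Finset.sum_eq_single k (fun l _ hl => by simp [h.cometric_apply hx, hl.symm])
    (by simp)]
  simp only [h.cometric_apply hx, h.pd_metric hx, if_true, eq_comm (a := k)]
  linear_combination ((if i = j then 1 else 0) * pd k u x - (if i = k then 1 else 0) * pd j u x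
    - (if j = k then 1 else 0) * pd i u x) * hexp

theorem pd_christoffel (h : X.IsConformallyFlat u) (hx : x ∈ X.carrier) (k i j l : Fin d) :
    pd l (X.christoffel k i j) x = (if i = j then 1 else 0) * pd l (pd k u) x
      + (-(if k = i then 1 else 0) * pd l (pd j u) x
        + -(if k = j then 1 else 0) * pd l (pd i u) x) := by
  have hchristoffel := eventually_of_mem (X.isOpen_carrier.mem_nhds hx)
    fun y hy => h.christoffel_eq hy k i j
  have hpd (m : Fin d) (c : ℝ) : DifferentiableAt ℝ (fun y => c * pd m u y) x :=
    (differentiableAt_pd (h.contDiffAt hx) m).const_mul c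
  rw [pd_congr_of_eventuallyEq hchristoffel, pd_add (hpd _ _) ((hpd _ _).fun_add (hpd _ _)),
    pd_add (hpd _ _) (hpd _ _), pd_const_mul, pd_const_mul, pd_const_mul]

theorem ricci_eq (h : X.IsConformallyFlat u) (hx : x ∈ X.carrier) (i k : Fin d) :
    X.ricci i k x = (d - 2) * (pd i (pd k u) x + pd i u x * pd k u x)
      + if i = k then Δ u x - (d - 2) * ‖∇ u x‖ ^ 2 else 0 := by
  have hu := h.contDiffAt hx
  simp only [ricci, riemann, h.pd_christoffel hx, h.christoffel_eq hx]
  rw [laplacian_eq_sum_pd_pd hu, ← real_inner_self_eq_norm_sq, inner_gradient_gradient]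
  simp only [mul_add, add_mul, neg_mul, mul_neg, ite_mul, mul_ite, one_mul, zero_mul, mul_zero,
    Finset.sum_add_distrib, Finset.sum_sub_distrib, Finset.sum_neg_distrib, Finset.sum_ite_eq,
    Finset.sum_ite_eq', Finset.mem_univ, if_true, Finset.sum_const, Finset.card_univ,
    Fintype.card_fin, nsmul_eq_mul, Finset.sum_ite_irrel, pd_comm hu k i]
  rcases eq_or_ne i k with rfl | hik
  · simp only [if_true]
    ring
  · simp only [hik, hik.symm, if_false]
    ring

theorem scalarCurvature_eq (h : X.IsConformallyFlat u) (hx : x ∈ X.carrier) :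
    X.scalarCurvature x
      = Real.exp (2 * u x) * ((d - 1) * (2 * Δ u x - (d - 2) * ‖∇ u x‖ ^ 2)) := by
  simp only [scalarCurvature, h.cometric_apply hx, h.ricci_eq hx, ite_mul, zero_mul,
    Finset.sum_ite_eq, Finset.mem_univ, if_true, ← Finset.mul_sum, Finset.sum_add_distrib,
    ← laplacian_eq_sum_pd_pd (h.contDiffAt hx), ← inner_gradient_gradient,
    real_inner_self_eq_norm_sq, Finset.sum_const, Finset.card_univ, Fintype.card_fin,
    nsmul_eq_mul]
  ring

theorem laplaceBeltrami_eq (h : X.IsConformallyFlat u) (hx : x ∈ X.carrier)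
    (hf : ContDiffAt ℝ 2 f x) :
    X.laplaceBeltrami f x
      = Real.exp (2 * u x) * (Δ f x - (d - 2) * inner ℝ (∇ u x) (∇ f x)) := by
  have hu := (h.contDiffAt hx).differentiableAt two_ne_zero
  have hflux (i : Fin d) :
      (fun y => ∑ j, √(X.metric y).det * X.cometric y i j * pd j f y) =ᶠ[𝓝 x]
        fun y => Real.exp ((2 - d) * u y) * pd i f y := by
    filter_upwards [X.isOpen_carrier.mem_nhds hx] with y hy
    simp only [h.sqrt_det_metric hy, h.cometric_apply hy, mul_ite, ite_mul, mul_zero, zero_mul,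
      Finset.sum_ite_eq, Finset.mem_univ, if_true, ← Real.exp_add]
    ring_nf
  have hpd (i : Fin d) :
      pd i (fun y => ∑ j, √(X.metric y).det * X.cometric y i j * pd j f y) x
        = Real.exp ((2 - d) * u x) * (pd i (pd i f) x - (d - 2) * (pd i u x * pd i f x)) := by
    rw [pd_congr_of_eventuallyEq (hflux i), pd_mul (hu.const_mul _).exp (differentiableAt_pd hf i),
      pd_exp (hu.const_mul _), pd_const_mul]
    ring
  have hexp : (Real.exp (-d * u x))⁻¹ * Real.exp ((2 - d) * u x) = Real.exp (2 * u x) := by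
    rw [← Real.exp_neg, ← Real.exp_add]
    ring_nf
  simp only [laplaceBeltrami, hpd, h.sqrt_det_metric hx, laplacian_eq_sum_pd_pd hf,
    inner_gradient_gradient, ← Finset.mul_sum, Finset.sum_sub_distrib]
  rw [← mul_assoc, hexp]

theorem carreDuChamp_eq (h : X.IsConformallyFlat u) (hx : x ∈ X.carrier) :
    X.carreDuChamp f x = Real.exp (2 * u x) * ‖∇ f x‖ ^ 2 := by
  simp only [carreDuChamp, h.cometric_apply hx, ite_mul, zero_mul, Finset.sum_ite_eq,
    Finset.mem_univ, if_true, mul_assoc, ← Finset.mul_sum, ← inner_gradient_gradient,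
    real_inner_self_eq_norm_sq]

theorem weight_eqOn (h : X.IsConformallyFlat u) (hV : ContDiffOn ℝ ∞ V X.carrier)
    (hμ : X.μ = (volume.restrict X.carrier).withDensity
      fun x => ENNReal.ofReal (Real.exp (-V x))) :
    EqOn X.weight (fun x => V x - d * u x) X.carrier := by
  refine X.weight_unique ((isWeight_iff X.isOpen_carrier X.contDiffOn_cometric
    X.posDef_cometric).2 ⟨hV.sub (contDiffOn_const.mul h.contDiffOn), hμ.trans ?_⟩)
  refine withDensity_congr_ae ?_
  filter_upwards [ae_restrict_mem X.isOpen_carrier.measurableSet] with x hx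
  rw [← metric, h.sqrt_det_metric hx, ← Real.exp_add]
  ring_nf

end IsConformallyFlat
end WeightedSpace

namespace WeightedSpace

variable {d : ℕ}

/-- In the coordinates `t = log ‖x‖`, `ω = x / ‖x‖` on `ℝ^d \ {0} = ℝ × S^{d-1}`, the metric of `X`
is `c(t)⁻² (dt² + dω²)` and its measure is `c(t)⁻ⁿ dt dω`. -/
structure IsConformalCylinder (X : WeightedSpace d) (n : ℝ) (c : ℝ → ℝ) : Prop where
  contDiff : ContDiff ℝ ∞ c
  ne_zero : ∀ x ∈ X.carrier, x ≠ 0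
  pos : ∀ x ∈ X.carrier, 0 < c (Real.log ‖x‖)
  cometric_eq : ∀ x ∈ X.carrier,
    X.cometric x = (‖x‖ * c (Real.log ‖x‖)) ^ 2 • (1 : Matrix (Fin d) (Fin d) ℝ)
  μ_eq : X.μ = (volume.restrict X.carrier).withDensity
    fun x => ENNReal.ofReal (‖x‖ ^ d * c (Real.log ‖x‖) ^ n)⁻¹

namespace IsConformalCylinder

variable {X : WeightedSpace d} {n γ α ε : ℝ} {c : ℝ → ℝ} {x : EuclideanSpace ℝ (Fin d)}

theorem contDiffAt_log (h : X.IsConformalCylinder n c) (hx : x ∈ X.carrier) :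
    ContDiffAt ℝ ∞ (fun t => Real.log (c t)) (Real.log ‖x‖) :=
  h.contDiff.contDiffAt.log (h.pos x hx).ne'

theorem contDiffAt_log_profile (h : X.IsConformalCylinder n c) (hx : x ∈ X.carrier) :
    ContDiffAt ℝ ∞ (fun y : EuclideanSpace ℝ (Fin d) => Real.log (c (Real.log ‖y‖))) x :=
  contDiffAt_comp_log_norm (h.ne_zero x hx) (h.contDiffAt_log hx)

theorem isConformallyFlat (h : X.IsConformalCylinder n c) :
    X.IsConformallyFlat fun x => Real.log ‖x‖ + Real.log (c (Real.log ‖x‖)) where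
  contDiffOn x hx := ((contDiffAt_comp_log_norm (h.ne_zero x hx) contDiffAt_id).add
    (h.contDiffAt_log_profile hx)).contDiffWithinAt
  cometric_eq x hx := by
    rw [h.cometric_eq x hx, exp_two_mul_log_add_log (norm_pos_iff.2 (h.ne_zero x hx)) (h.pos x hx)]

theorem weight_eqOn (h : X.IsConformalCylinder n c) :
    EqOn X.weight (fun x => (n - d) * Real.log (c (Real.log ‖x‖))) X.carrier := by
  have hV : ContDiffOn ℝ ∞ (fun x => d * Real.log ‖x‖ + n * Real.log (c (Real.log ‖x‖)))
      X.carrier := fun x hx =>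
    ((contDiffAt_const.mul (contDiffAt_comp_log_norm (h.ne_zero x hx) contDiffAt_id)).add
      (contDiffAt_const.mul (h.contDiffAt_log_profile hx))).contDiffWithinAt
  refine (h.isConformallyFlat.weight_eqOn hV (h.μ_eq.trans (withDensity_congr_ae ?_))).trans
    fun x _ => by ring
  filter_upwards [ae_restrict_mem X.isOpen_carrier.measurableSet] with x hx
  rw [Real.exp_neg, Real.exp_add, Real.exp_nat_mul, Real.exp_log (norm_pos_iff.2 (h.ne_zero x hx)),
    mul_comm n, Real.rpow_def_of_pos (h.pos x hx)]

theorem hasDerivAt_log (h : X.IsConformalCylinder n c) (hx : x ∈ X.carrier) :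
    HasDerivAt (fun t => Real.log (c t))
      (deriv c (Real.log ‖x‖) / c (Real.log ‖x‖)) (Real.log ‖x‖) :=
  (h.contDiff.differentiable (by simp) _).hasDerivAt.log (h.pos x hx).ne'

theorem laplacian_log_profile (h : X.IsConformalCylinder n c) (hx : x ∈ X.carrier) :
    Δ (fun y : EuclideanSpace ℝ (Fin d) => Real.log (c (Real.log ‖y‖))) x
      = ((deriv (deriv c) (Real.log ‖x‖) * c (Real.log ‖x‖) - deriv c (Real.log ‖x‖) ^ 2)
          / c (Real.log ‖x‖) ^ 2
        + (d - 2) * (deriv c (Real.log ‖x‖) / c (Real.log ‖x‖))) / ‖x‖ ^ 2 := by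
  rw [laplacian_comp_log_norm (h := fun t => Real.log (c t)) (h.ne_zero x hx)
    ((h.contDiffAt_log hx).of_le ENat.LEInfty.out),
    deriv_deriv_log (h.contDiff.contDiffAt.of_le ENat.LEInfty.out) (h.pos x hx).ne',
    (h.hasDerivAt_log hx).deriv]

theorem scalarCurvature_eq (h : X.IsConformalCylinder n c) (hx : x ∈ X.carrier) :
    X.scalarCurvature x = (d - 1) * (2 * (c (Real.log ‖x‖) * deriv (deriv c) (Real.log ‖x‖))
      + (d - 2) * c (Real.log ‖x‖) ^ 2 - d * deriv c (Real.log ‖x‖) ^ 2) := by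
  have hx0 : x ≠ 0 := h.ne_zero x hx
  have hnorm : ‖x‖ ≠ 0 := norm_ne_zero_iff.2 hx0
  have hc : c (Real.log ‖x‖) ≠ 0 := (h.pos x hx).ne'
  have hlaplacian_log : Δ (fun y : EuclideanSpace ℝ (Fin d) => Real.log ‖y‖) x
      = (d - 2) / ‖x‖ ^ 2 := by
    simpa using laplacian_comp_log_norm (h := fun t => t) hx0 contDiffAt_id
  have hlaplacian := ContDiffAt.laplacian_add (contDiffAt_comp_log_norm hx0 contDiffAt_id)
    ((h.contDiffAt_log_profile hx).of_le ENat.LEInfty.out)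
  simp only [id, Pi.add_def, hlaplacian_log, h.laplacian_log_profile hx] at hlaplacian
  have hderiv := (hasDerivAt_id _).add (h.hasDerivAt_log hx)
  have hgradient := inner_gradient_comp_log_norm hx0 hderiv hderiv
  simp only [Pi.add_def, real_inner_self_eq_norm_sq, id] at hgradient
  rw [h.isConformallyFlat.scalarCurvature_eq hx, hlaplacian, hgradient,
    exp_two_mul_log_add_log (norm_pos_iff.2 hx0) (h.pos x hx)]
  field_simp
  ring

theorem laplaceBeltrami_weight (h : X.IsConformalCylinder n c) (hx : x ∈ X.carrier) :
    X.laplaceBeltrami X.weight x = (n - d) * (c (Real.log ‖x‖) * deriv (deriv c) (Real.log ‖x‖)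
      - (d - 1) * deriv c (Real.log ‖x‖) ^ 2) := by
  have hx0 : x ≠ 0 := h.ne_zero x hx
  have hnorm : ‖x‖ ≠ 0 := norm_ne_zero_iff.2 hx0
  have hc : c (Real.log ‖x‖) ≠ 0 := (h.pos x hx).ne'
  have hsmooth := (h.contDiffAt_log_profile hx).of_le (m := 2) ENat.LEInfty.out
  have hweight := h.weight_eqOn.eventuallyEq_of_mem (X.isOpen_carrier.mem_nhds hx)
  have hlaplacian := laplacian_smul (n - d) hsmooth
  simp only [Pi.smul_def, smul_eq_mul] at hlaplacian
  have hgradient := inner_gradient_comp_log_norm hx0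
    ((hasDerivAt_id _).add (h.hasDerivAt_log hx)) ((h.hasDerivAt_log hx).const_mul (n - d))
  simp only [Pi.add_def, id] at hgradient
  rw [h.isConformallyFlat.laplaceBeltrami_eq hx
    (((contDiffAt_const (c := n - d)).mul hsmooth).congr_of_eventuallyEq hweight),
    (laplacian_congr_nhds hweight).self_of_nhds, hweight.gradient_eq, hlaplacian, hgradient,
    h.laplacian_log_profile hx, exp_two_mul_log_add_log (norm_pos_iff.2 hx0) (h.pos x hx)]
  field_simp
  ring

theorem carreDuChamp_weight (h : X.IsConformalCylinder n c) (hx : x ∈ X.carrier) :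
    X.carreDuChamp X.weight x = (n - d) ^ 2 * deriv c (Real.log ‖x‖) ^ 2 := by
  have hx0 : x ≠ 0 := h.ne_zero x hx
  have hnorm : ‖x‖ ≠ 0 := norm_ne_zero_iff.2 hx0
  have hc : c (Real.log ‖x‖) ≠ 0 := (h.pos x hx).ne'
  have hweight := h.weight_eqOn.eventuallyEq_of_mem (X.isOpen_carrier.mem_nhds hx)
  have hderiv := (h.hasDerivAt_log hx).const_mul (n - d)
  rw [h.isConformallyFlat.carreDuChamp_eq hx, hweight.gradient_eq, ← real_inner_self_eq_norm_sq,
    inner_gradient_comp_log_norm hx0 hderiv hderiv,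
    exp_two_mul_log_add_log (norm_pos_iff.2 hx0) (h.pos x hx)]
  field_simp

theorem invariantS_eq (h : X.IsConformalCylinder n c) (hn : n ≠ d)
    (hγ : 4 * (d - 1) - 2 * γ * (n - d) ≠ 0) (hx : x ∈ X.carrier) :
    X.invariantS n γ x = thetaCoeff d n γ * ((d - 1) * (d - 2)) * c (Real.log ‖x‖) ^ 2
      + (n - 2) / 2 * (c (Real.log ‖x‖) * deriv (deriv c) (Real.log ‖x‖))
      - n * (n - 2) / 4 * deriv c (Real.log ‖x‖) ^ 2 := by
  have : n - d ≠ 0 := sub_ne_zero.2 hn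
  rw [invariantS, h.scalarCurvature_eq hx, h.laplaceBeltrami_weight hx, h.carreDuChamp_weight hx,
    thetaCoeff, betaCoeff]
  field_simp
  ring

theorem invariantS_eq_const {f : ℝ → ℝ} (h : X.IsConformalCylinder n fun t => f (α * t))
    (hf' : ∀ t, deriv f t ^ 2 = f t ^ 2 - ε) (hf'' : ∀ t, deriv (deriv f) t = f t) (hn : n ≠ d)
    (hγ : 4 * (d - 1) - 2 * γ * (n - d) ≠ 0)
    (hθ : thetaCoeff d n γ * ((d - 1) * (d - 2)) = ((n - 2) / 2 * α) ^ 2) (hx : x ∈ X.carrier) :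
    X.invariantS n γ x = ε * (n * (n - 2) / 4 * α ^ 2) := by
  have hderiv : deriv (fun t => f (α * t)) = fun t => α * deriv f (α * t) :=
    funext (deriv_comp_mul_left α f)
  have hderiv_deriv (t : ℝ) : deriv (fun t => α * deriv f (α * t)) t = α ^ 2 * f (α * t) := by
    rw [deriv_const_mul_field, deriv_comp_mul_left, hf'', smul_eq_mul]
    ring
  rw [h.invariantS_eq hn hγ hx, hθ, hderiv, hderiv_deriv, mul_pow α, hf']
  ring

end IsConformalCylinder

theorem ofScalar_isConformalCylinder {U : Set (EuclideanSpace ℝ (Fin d))}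
    {hU : IsOpen U} {q m w : EuclideanSpace ℝ (Fin d) → ℝ} {hq : ContDiffOn ℝ ∞ q U}
    {hq0 : ∀ x ∈ U, 0 < q x} {hm : ContDiffOn ℝ ∞ m U} {hm0 : ∀ x ∈ U, 0 < m x} {n α : ℝ}
    {c : ℝ → ℝ} (hc : ContDiff ℝ ∞ c) (hU0 : ∀ x ∈ U, x ≠ 0) (hw : ∀ x ∈ U, 0 < w x)
    (hcw : ∀ x ∈ U, c (Real.log ‖x‖) = ‖x‖ ^ (-α) * w x)
    (hqw : ∀ x ∈ U, q x = ‖x‖ ^ (2 * (1 - α)) * w x ^ 2)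
    (hmw : ∀ x ∈ U, m x = ‖x‖ ^ (n * α - d) / w x ^ n) :
    (ofScalar U hU q m hq hq0 hm hm0).IsConformalCylinder n c where
  contDiff := hc
  ne_zero := hU0
  pos x hx := by
    rw [hcw x hx]
    exact mul_pos (Real.rpow_pos_of_pos (norm_pos_iff.2 (hU0 x hx)) _) (hw x hx)
  cometric_eq x hx := by
    have hx0 : 0 < ‖x‖ := norm_pos_iff.2 (hU0 x hx)
    refine congrArg (· • (1 : Matrix (Fin d) (Fin d) ℝ)) ?_
    rw [hqw x hx, hcw x hx, ← mul_assoc, mul_pow, mul_comm (2 : ℝ),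
      Real.rpow_mul hx0.le, Real.rpow_two, sub_eq_add_neg, Real.rpow_add hx0, Real.rpow_one]
  μ_eq := by
    refine withDensity_congr_ae ?_
    filter_upwards [ae_restrict_mem hU.measurableSet] with x hx
    have hx0 : 0 < ‖x‖ := norm_pos_iff.2 (hU0 x hx)
    rw [hmw x hx, hcw x hx, Real.mul_rpow (by positivity) (hw x hx).le, ← Real.rpow_mul hx0.le,
      ← Real.rpow_natCast, ← mul_assoc, ← Real.rpow_add hx0, mul_inv, ← Real.rpow_neg hx0.le,
      div_eq_mul_inv]
    ring_nf

end WeightedSpace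

namespace CKN

variable {d : ℕ} {a b : ℝ}

theorem n_ne_d (hd : (d : ℝ) ≠ 0) (hab : a ≠ b) (hba : b ≠ a + 1) : n d a b ≠ d := by
  have hba' : 1 + a - b ≠ 0 := fun h => hba (by linarith)
  rw [n, Ne, div_eq_iff hba', left_eq_mul₀ hd]
  exact fun h => hab (by linarith)

theorem n_ne_two (hba : b ≠ a + 1) (hp : (d : ℝ) - 2 + 2 * (b - a) ≠ 0) : n d a b ≠ 2 := by
  have hba' : 1 + a - b ≠ 0 := fun h => hba (by linarith)
  rw [n, Ne, div_eq_iff hba']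
  exact fun h => hp (by linarith)

theorem α_ne_zero (hba : b ≠ a + 1) (hp : (d : ℝ) - 2 + 2 * (b - a) ≠ 0)
    (ha : a ≠ ((d : ℝ) - 2) / 2) : α d a b ≠ 0 := by
  have hα : α d a b = 2 * (((d : ℝ) - 2) / 2 - a) * (1 + a - b) / (d - 2 + 2 * (b - a)) := by
    rw [α, p]
    field_simp
    ring
  rw [hα]
  exact div_ne_zero (mul_ne_zero (mul_ne_zero two_ne_zero (sub_ne_zero.2 ha.symm))
    fun h => hba (by linarith)) hp

theorem n_mul_α (hba : b ≠ a + 1) (hp : (d : ℝ) - 2 + 2 * (b - a) ≠ 0) :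
    n d a b * α d a b = d - b * p d a b := by
  have hba' : 1 + a - b ≠ 0 := fun h => hba (by linarith)
  rw [n, α, p]
  field_simp
  ring

theorem γ₀_denominator_eq (hnd : n d a b ≠ d) (hn2 : n d a b ≠ 2) (hα : α d a b ≠ 0) :
    4 * (d - 1) - 2 * γ₀ d a b * (n d a b - d)
      = 4 * ((d - 1) * (d - 2)) / (α d a b ^ 2 * (n d a b - 2)) := by
  have hnd' : n d a b - d ≠ 0 := sub_ne_zero.2 hnd
  have hn2' : n d a b - 2 ≠ 0 := sub_ne_zero.2 hn2
  rw [γ₀, bDGZ]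
  field_simp
  ring

theorem thetaCoeff_γ₀_mul (hd1 : (d : ℝ) - 1 ≠ 0) (hd2 : (d : ℝ) - 2 ≠ 0)
    (hnd : n d a b ≠ d) (hn2 : n d a b ≠ 2) (hα : α d a b ≠ 0) :
    thetaCoeff d (n d a b) (γ₀ d a b) * ((d - 1) * (d - 2))
      = ((n d a b - 2) / 2 * α d a b) ^ 2 := by
  have hn2' : n d a b - 2 ≠ 0 := sub_ne_zero.2 hn2
  rw [thetaCoeff, γ₀_denominator_eq hnd hn2 hα]
  field_simp
  ring

theorem euclidean_isConformalCylinder (hnα : n d a b * α d a b = d - b * p d a b) :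
    (euclidean d a b).IsConformalCylinder (n d a b) fun t => Real.exp (-(α d a b * t)) := by
  refine WeightedSpace.ofScalar_isConformalCylinder (w := fun _ => 1) (α := α d a b) (by fun_prop)
    (fun _ hx => hx) (fun _ _ => one_pos) (fun x hx => ?_) (fun x _ => ?_) (fun x _ => ?_)
  · rw [mul_one, Real.rpow_def_of_pos (norm_pos_iff.2 hx), mul_comm (α d a b), mul_neg]
  · rw [one_pow, mul_one]
  · rw [hnα, sub_sub_cancel_left, Real.one_rpow, div_one]

theorem spherical_isConformalCylinder (hnα : n d a b * α d a b = d - b * p d a b) :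
    (spherical d a b).IsConformalCylinder (n d a b) fun t => Real.cosh (α d a b * t) := by
  refine WeightedSpace.ofScalar_isConformalCylinder (w := fun x => (1 + ‖x‖ ^ (2 * α d a b)) / 2)
    (α := α d a b) (by fun_prop) (fun _ hx => hx) (fun _ _ => by positivity) (fun x hx => ?_)
    (fun x _ => ?_) (fun x _ => ?_)
  · have hx0 : 0 < ‖x‖ := norm_pos_iff.2 hx
    rw [Real.cosh_eq, mul_div_assoc', mul_add, mul_one, ← Real.rpow_add hx0,
      Real.rpow_def_of_pos hx0, Real.rpow_def_of_pos hx0]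
    ring_nf
  · ring
  · rw [hnα, sub_sub_cancel_left, two_rpow_mul_div_rpow _ _ (by positivity)]

theorem hyperbolic_isConformalCylinder (hα : 0 < α d a b)
    (hnα : n d a b * α d a b = d - b * p d a b) :
    (hyperbolic d a b hα).IsConformalCylinder (n d a b) fun t => -Real.sinh (α d a b * t) := by
  refine WeightedSpace.ofScalar_isConformalCylinder (w := fun x => (1 - ‖x‖ ^ (2 * α d a b)) / 2)
    (α := α d a b) (by fun_prop) (fun _ hx => hx.2) (fun _ hx => half_pos (one_sub_pos hα hx))
    (fun x hx => ?_) (fun x _ => ?_) (fun x hx => ?_)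
  · have hx0 : 0 < ‖x‖ := norm_pos_iff.2 hx.2
    rw [Real.sinh_eq, mul_div_assoc', mul_sub, mul_one, ← Real.rpow_add hx0,
      Real.rpow_def_of_pos hx0, Real.rpow_def_of_pos hx0]
    ring_nf
  · ring
  · rw [hnα, sub_sub_cancel_left, two_rpow_mul_div_rpow _ _ (one_sub_pos hα hx).le]

theorem invariantS_γ₀ {X : WeightedSpace d} {f : ℝ → ℝ} {ε : ℝ} (hd : 3 ≤ d) (hab : a ≠ b)
    (hba : b ≠ a + 1) (hp : (d : ℝ) - 2 + 2 * (b - a) ≠ 0) (ha : a ≠ ((d : ℝ) - 2) / 2)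
    (hX : X.IsConformalCylinder (n d a b) fun t => f (α d a b * t))
    (hf' : ∀ t, deriv f t ^ 2 = f t ^ 2 - ε) (hf'' : ∀ t, deriv (deriv f) t = f t)
    {x : EuclideanSpace ℝ (Fin d)} (hx : x ∈ X.carrier) :
    X.invariantS (n d a b) (γ₀ d a b) x
      = ε * (n d a b * (n d a b - 2) / 4 * α d a b ^ 2) := by
  have hd' : (3 : ℝ) ≤ d := mod_cast hd
  have hd1 : (d : ℝ) - 1 ≠ 0 := by linarith
  have hd2 : (d : ℝ) - 2 ≠ 0 := by linarith
  have hnd := n_ne_d (by linarith) hab hba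
  have hn2 := n_ne_two hba hp
  have hα := α_ne_zero hba hp ha
  refine hX.invariantS_eq_const hf' hf'' hnd ?_ (thetaCoeff_γ₀_mul hd1 hd2 hnd hn2 hα) hx
  rw [γ₀_denominator_eq hnd hn2 hα]
  exact div_ne_zero (mul_ne_zero four_ne_zero (mul_ne_zero hd1 hd2))
    (mul_ne_zero (pow_ne_zero 2 hα) (sub_ne_zero.2 hn2))

end CKN

theorem proposition4_general (d : ℕ) (hd : 3 ≤ d) (a b : ℝ) (hab : a ≠ b) (hba : b ≠ a + 1)
    (hp : (d : ℝ) - 2 + 2 * (b - a) ≠ 0) (ha : a ≠ ((d : ℝ) - 2) / 2) :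
    (∀ x ∈ (CKN.euclidean d a b).carrier,
      (CKN.euclidean d a b).invariantS (CKN.n d a b) (CKN.γ₀ d a b) x = 0) ∧
    (∀ x ∈ (CKN.spherical d a b).carrier,
      (CKN.spherical d a b).invariantS (CKN.n d a b) (CKN.γ₀ d a b) x
        = CKN.n d a b * (CKN.n d a b - 2) / 4 * CKN.α d a b ^ 2) ∧
    (∀ hα : 0 < CKN.α d a b, ∀ x ∈ (CKN.hyperbolic d a b hα).carrier,
      (CKN.hyperbolic d a b hα).invariantS (CKN.n d a b) (CKN.γ₀ d a b) x
        = -(CKN.n d a b * (CKN.n d a b - 2) / 4 * CKN.α d a b ^ 2)) := by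
  have hnα := CKN.n_mul_α hba hp
  refine ⟨fun x hx => ?_, fun x hx => ?_, fun hα x hx => ?_⟩
  · exact (CKN.invariantS_γ₀ (f := fun t => Real.exp (-t)) (ε := 0) hd hab hba hp ha
      (CKN.euclidean_isConformalCylinder hnα) (fun t => by simp [deriv_exp_neg_eq])
      (fun t => by simp [deriv_exp_neg_eq]) hx).trans (zero_mul _)
  · exact (CKN.invariantS_γ₀ (ε := 1) hd hab hba hp ha (CKN.spherical_isConformalCylinder hnα)
      (fun t => by simp [Real.sinh_sq]) (fun t => by simp) hx).trans (one_mul _)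
  · exact (CKN.invariantS_γ₀ (f := fun t => -Real.sinh t) (ε := -1) hd hab hba hp ha
      (CKN.hyperbolic_isConformalCylinder hα hnα) (fun t => by simp [Real.cosh_sq])
      (fun t => by simp) hx).trans (neg_one_mul _)

theorem proposition4 (d : ℕ) (hd : 3 ≤ d) (a b : ℝ) (hab : a < b) (hba : b < a + 1)
    (ha : a < ((d : ℝ) - 2) / 2) :
    (∀ x ∈ (CKN.euclidean d a b).carrier,
      (CKN.euclidean d a b).invariantS (CKN.n d a b) (CKN.γ₀ d a b) x = 0) ∧
    (∀ x ∈ (CKN.spherical d a b).carrier,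
      (CKN.spherical d a b).invariantS (CKN.n d a b) (CKN.γ₀ d a b) x
        = CKN.n d a b * (CKN.n d a b - 2) / 4 * CKN.α d a b ^ 2) ∧
    (∀ x ∈ (CKN.hyperbolic d a b (CKN.α_pos hd hab.le hba ha)).carrier,
      (CKN.hyperbolic d a b (CKN.α_pos hd hab.le hba ha)).invariantS
          (CKN.n d a b) (CKN.γ₀ d a b) x
        = -(CKN.n d a b * (CKN.n d a b - 2) / 4 * CKN.α d a b ^ 2)) :=
  have hd' : (3 : ℝ) ≤ d := mod_cast hd
  have hp : (d : ℝ) - 2 + 2 * (b - a) ≠ 0 := by linarith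
  (proposition4_general d hd a b hab.ne hba.ne hp ha.ne).imp_right (And.imp_right fun h => h _)
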